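/- Let $n,d\ge 1$, let $\mathbb{S}^{d-1}$ be the unit sphere of $\mathbb{R}^d$ and let $\mu$ be the uniform (Haar) probability measure on it. Let $\eta^{(i)}_j\ge 0$ for $i,j\in[n]$ be real numbers ($\eta^{(i)}_j$ is the influence of agent $j$ on agent $i$). Let $A=A(\bm\eta)$ be the $n\times n$ matrix with $A_{ij}=1$ if $\eta^{(i)}_j>0$ and $A_{ij}=0$ otherwise, and suppose that $A$ is irreducible, that is, the directed graph with an edge $i\to j$ whenever $A_{ij}=1$ contains a directed path (possibly of length $0$) from every $i$ to every $j$; in particular this holds if $A^n>0$ entrywise. Let $\xi_0,\xi_1,\dots$ be i.i.d. random vectors in $\mathbb{S}^{d-1}$ whose law $\mathcal{D}$ is equivalent to $\mu$ in the sense that there are constants $C,C'>0$ with $C\mu(B)\le \mathcal{D}(B)\le C'\mu(B)$ for every measurable $B\subseteq\mathbb{S}^{d-1}$. Given any deterministic starting configuration $\mathbf{X}_0=(\mathbf{X}_0^{(1)},\dots,\mathbf{X}_0^{(n)})\in(\mathbb{S}^{d-1})^n$, let $(\mathbf{X}_t)_{t\ge0}$ be the party model: $\mathbf{X}_{t+1}^{(i)}=\mathbf{U}_t^{(i)}/\|\mathbf{U}_t^{(i)}\|_2$,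 where $$\mathbf{U}_t^{(i)}=\mathbf{X}_t^{(i)}+\sum_{j:\,s_t^{(j)}=s_t^{(i)}}\eta^{(i)}_j\mathbf{X}_t^{(j)}-\sum_{j:\,s_t^{(j)}\ne s_t^{(i)}}\eta^{(i)}_j\mathbf{X}_t^{(j)},\qquad s_t^{(j)}=\operatorname{sgn}\langle \mathbf{X}_t^{(j)},\xi_t\rangle,\quad \operatorname{sgn}(0)=0$$ (on the event of probability zero that $\mathbf{U}_t^{(i)}=\mathbf{0}$, put $\mathbf{X}_{t+1}^{(i)}=\mathbf{X}_t^{(i)}$). Then the system strongly polarizes from $\mathbf{X}_0$: almost surely $\rho(\mathbf{X}_t,P)\to0$ as $t\to\infty$, where $P=\{(\sigma_1\mathbf{x},\dots,\sigma_n\mathbf{x}):\mathbf{x}\in\mathbb{S}^{d-1},\ \bm\sigma\in\{-1,1\}^n\}$ is the set of polarized configurations and $\rho(\mathbf{X},P)=\inf_{\mathbf{Y}\in P}\|\mathbf{X}-\mathbf{Y}\|_2$ is the Euclidean distance in $(\mathbb{R}^d)^n$. -/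

import Mathlib

open MeasureTheory ProbabilityTheory Filter Topology

noncomputable section

namespace PartyModel

/-- `ℝ^d` with the Euclidean norm. -/
abbrev E (d : ℕ) : Type := EuclideanSpace ℝ (Fin d)

/-- The unit sphere `S^{d-1}` of `ℝ^d`. -/
abbrev Sphere (d : ℕ) : Type := Metric.sphere (0 : E d) 1

/-- A joint opinion vector: one unit vector for each of the `n` agents. -/
abbrev Config (n d : ℕ) : Type := Fin n → Sphere d

/-- A joint opinion vector as a point of the Euclidean space `(ℝ^d)^n` (with the `ℓ²` norm). -/
def Config.toEuclidean {n d : ℕ} (X : Config n d) : PiLp 2 (fun _ : Fin n => E d) :=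
  WithLp.toLp 2 (fun i => (X i : E d))

/-- The set `σ(D)` of all `(σ₁ x, …, σₙ x)` with `x` on the unit sphere. -/
def signedDiagonal {n : ℕ} (d : ℕ) (σ : Fin n → ℤˣ) : Set (PiLp 2 (fun _ : Fin n => E d)) :=
  {Y | ∃ x : Sphere d, ∀ i, Y i = ((σ i : ℤ) : ℝ) • (x : E d)}

/-- The set `P` of polarized vectors: the union of the `σ(D)` over all sign vectors `σ`. -/
def polarizedSet (n d : ℕ) : Set (PiLp 2 (fun _ : Fin n => E d)) :=
  ⋃ σ : Fin n → ℤˣ, signedDiagonal d σ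

/-- Strong polarization of a random sequence of joint opinion vectors: almost surely, the Euclidean
distance to the set of polarized vectors tends to zero. -/
def StronglyPolarizes {n d : ℕ} {Ω : Type*} [MeasurableSpace Ω] (Pr : Measure Ω)
    (X : ℕ → Ω → Config n d) : Prop :=
  ∀ᵐ ω ∂Pr, Tendsto (fun t => Metric.infDist (X t ω).toEuclidean (polarizedSet n d)) atTop (𝓝 0)

open Classical in
/-- The unnormalized update of agent `i`. Here `η i j ≥ 0` is the influence of agent `j` on
agent `i`, and `SignType.sign 0 = 0`. -/
def unnormalizedUpdate {n d : ℕ} (η : Fin n → Fin n → ℝ) (ξ : Sphere d) (X : Config n d)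
    (i : Fin n) : E d :=
  (X i : E d) +
    ((∑ j with SignType.sign (inner ℝ (X j : E d) (ξ : E d)) =
          SignType.sign (inner ℝ (X i : E d) (ξ : E d)), η i j • (X j : E d)) -
      ∑ j with SignType.sign (inner ℝ (X j : E d) (ξ : E d)) ≠
          SignType.sign (inner ℝ (X i : E d) (ξ : E d)), η i j • (X j : E d))

/-- For nonnegative influences the unnormalized update can vanish only if `ξ` is orthogonal to the
agent's opinion, an event of probability zero under every law absolutely continuous with respect to
the surface measure. -/
theorem unnormalizedUpdate_ne_zero {n d : ℕ} {η : Fin n → Fin n → ℝ} (hη : ∀ i j, 0 ≤ η i j)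
    (ξ : Sphere d) (X : Config n d) (i : Fin n)
    (h : inner ℝ (X i : E d) (ξ : E d) ≠ 0) : unnormalizedUpdate η ξ X i ≠ 0 := by
  intro h0
  have h1 : inner ℝ (unnormalizedUpdate η ξ X i) (ξ : E d) = 0 := by rw [h0, inner_zero_left]
  simp only [unnormalizedUpdate, inner_add_left, inner_sub_left, sum_inner,
    real_inner_smul_left] at h1
  rcases lt_or_gt_of_ne h with hi | hi
  · have ha := Finset.sum_nonpos (s := Finset.univ.filter fun j =>
      SignType.sign (inner ℝ (X j : E d) (ξ : E d)) = SignType.sign (inner ℝ (X i : E d) (ξ : E d)))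
      (f := fun j => η i j * inner ℝ (X j : E d) (ξ : E d)) (fun j hj => by
        rw [Finset.mem_filter, sign_neg hi, sign_eq_neg_one_iff] at hj
        exact mul_nonpos_of_nonneg_of_nonpos (hη i j) hj.2.le)
    have hb := Finset.sum_nonneg (s := Finset.univ.filter fun j =>
      SignType.sign (inner ℝ (X j : E d) (ξ : E d)) ≠ SignType.sign (inner ℝ (X i : E d) (ξ : E d)))
      (f := fun j => η i j * inner ℝ (X j : E d) (ξ : E d)) (fun j hj => by
        rw [Finset.mem_filter, sign_neg hi, ne_eq, sign_eq_neg_one_iff, not_lt] at hj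
        exact mul_nonneg (hη i j) hj.2)
    linarith
  · have ha := Finset.sum_nonneg (s := Finset.univ.filter fun j =>
      SignType.sign (inner ℝ (X j : E d) (ξ : E d)) = SignType.sign (inner ℝ (X i : E d) (ξ : E d)))
      (f := fun j => η i j * inner ℝ (X j : E d) (ξ : E d)) (fun j hj => by
        rw [Finset.mem_filter, sign_pos hi, sign_eq_one_iff] at hj
        exact mul_nonneg (hη i j) hj.2.le)
    have hb := Finset.sum_nonpos (s := Finset.univ.filter fun j =>
      SignType.sign (inner ℝ (X j : E d) (ξ : E d)) ≠ SignType.sign (inner ℝ (X i : E d) (ξ : E d)))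
      (f := fun j => η i j * inner ℝ (X j : E d) (ξ : E d)) (fun j hj => by
        rw [Finset.mem_filter, sign_pos hi, ne_eq, sign_eq_one_iff, not_lt] at hj
        exact mul_nonpos_of_nonneg_of_nonpos (hη i j) hj.2)
    linarith

open Classical in
/-- One step of the party model: every agent moves to the normalized update. If the unnormalized
update vanishes, which forces `⟨X i, ξ⟩ = 0` when `η ≥ 0`, the agent keeps its opinion. -/
def step {n d : ℕ} (η : Fin n → Fin n → ℝ) (ξ : Sphere d) (X : Config n d) : Config n d :=
  fun i =>
    if h : unnormalizedUpdate η ξ X i = 0 then X i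
    else ⟨‖unnormalizedUpdate η ξ X i‖⁻¹ • unnormalizedUpdate η ξ X i, by
      rw [mem_sphere_zero_iff_norm, norm_smul, norm_inv, norm_norm,
        inv_mul_cancel₀ (norm_ne_zero_iff.mpr h)]⟩

/-- The joint opinion vector at time `t`, started at `x₀` and driven by the update vectors
`ξ 0, ξ 1, …`. -/
def trajectory {n d : ℕ} (η : Fin n → Fin n → ℝ) (x₀ : Config n d) (ξ : ℕ → Sphere d) :
    ℕ → Config n d
  | 0 => x₀
  | t + 1 => step η (ξ t) (trajectory η x₀ ξ t)

open Classical in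
/-- The adjacency matrix `A(η)` of the influence graph: an edge from `i` to `j` if `j` influences
`i`. -/
def influenceMatrix {n : ℕ} (η : Fin n → Fin n → ℝ) : Matrix (Fin n) (Fin n) ℕ :=
  Matrix.of fun i j => if 0 < η i j then 1 else 0

/-- Irreducibility of an adjacency matrix: there is a directed path (of some length `k ≥ 0`) from
any node to any node; `(A ^ k) i j` is the number of walks of length `k` from `i` to `j`. -/
def IsIrreducible {n : ℕ} (A : Matrix (Fin n) (Fin n) ℕ) : Prop :=
  ∀ i j, ∃ k : ℕ, 0 < (A ^ k) i j

/-- In particular, a matrix whose `n`-th power is entrywise positive is irreducible. -/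
theorem IsIrreducible.of_pow_pos {n : ℕ} {A : Matrix (Fin n) (Fin n) ℕ}
    (h : ∀ i j, 0 < (A ^ n) i j) : IsIrreducible A :=
  fun i j => ⟨n, h i j⟩

/-- The uniform (Haar) probability measure on the unit sphere: the normalized surface measure. -/
def uniformMeasure (d : ℕ) : Measure (Sphere d) :=
  ((volume : Measure (E d)).toSphere Set.univ)⁻¹ • (volume : Measure (E d)).toSphere

/-- `𝒟` is equivalent to the uniform measure, with constants: `C μ(B) ≤ 𝒟(B) ≤ C' μ(B)`. -/
def EquivalentToUniform {d : ℕ} (𝒟 : Measure (Sphere d)) : Prop :=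
  ∃ C C' : NNReal, 0 < C ∧ 0 < C' ∧ ∀ B : Set (Sphere d), MeasurableSet B →
    (C : ENNReal) * uniformMeasure d B ≤ 𝒟 B ∧ 𝒟 B ≤ (C' : ENNReal) * uniformMeasure d B

end PartyModel

end

open MeasureTheory ProbabilityTheory Filter Topology

noncomputable section

namespace PartyModel

/-! ### Products of stochastic matrices. -/

section Averaging

variable {ι V : Type*} [Fintype ι] [NormedAddCommGroup V] [NormedSpace ℝ V]

/-! Suppose that, after flipping some opinions by signs `s`, the direction `ξ` has all of them
strictly on one side. Then agents with equal signs attract and agents with opposite signs repel.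
Repulsion from `-y` is attraction to `y`, so the flipped opinions make a step of `consensus`, which
does not involve `ξ` (`step_flip`). Seen through a central projection, that step averages with a
stochastic matrix. Caps smaller than a hemisphere are preserved, which bounds the weights on edges
and loops from below, and irreducibility then yields contraction like `K * r ^ t`
(`exists_consensus_contraction`).

This contraction is used twice. After `T` consensus steps the diameters are at most `K * r ^ (T +
t)`, and a separating direction must lie in one of `n` slabs of that width. Slabs have measure of
the order of their width, so a union bound over `t` bounds the probability of not polarizing by `L *
r ^ T` (`failureProb_flip_le`). On the other hand, every configuration has signs for which the
directions in a common cap have probability at least a uniform `b` (`exists_flip_cap`). If `T`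
successive directions fall in this cap, the flipped system has made exactly `T` consensus steps, and
this has probability at least `b ^ T`.

Let `M` be the supremum of the failure probability over all starting points. Conditioning on this
event gives `b ^ T * (M - L * r ^ T) ≤ M - failureProb 𝒟 η y` for every `y`. The left side is
independent of `y`, so it cannot be positive; hence `M ≤ L * r ^ T` for every `T`, and `M = 0`. How
`b` compares with `r` plays no role. -/

/-- Averaging with stochastic rows all of whose entries are at least `α` contracts the diameter by
the factor `1 - α`. -/
theorem norm_average_sub_average_le {R : Matrix ι ι ℝ} {α D : ℝ} {z : ι → V}
    (hR : ∀ i j, 0 ≤ R i j) (hsum : ∀ i, ∑ j, R i j = 1) (hα : ∀ i j, α ≤ R i j)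
    (hD : ∀ i j, ‖z i - z j‖ ≤ D) (i j : ι) :
    ‖∑ k, R i k • z k - ∑ k, R j k • z k‖ ≤ (1 - α) * D := by
  classical
  have hD0 : 0 ≤ D := (norm_nonneg _).trans (hD i i)
  have key : ∀ (p : ι) (v : V), ∑ k, R p k • z k - v = ∑ k, R p k • (z k - v) := by
    intro p v
    simp only [smul_sub, Finset.sum_sub_distrib, ← Finset.sum_smul, hsum, one_smul]
  -- Against the single point `z k`, the summand `l = k` vanishes, so only the mass `1 - R j k`
  -- contributes.
  have inner_bound : ∀ k, ‖z k - ∑ l, R j l • z l‖ ≤ (1 - α) * D := by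
    intro k
    rw [← norm_neg, neg_sub, key, ← Finset.sum_erase_add _ _ (Finset.mem_univ k), sub_self,
      smul_zero, add_zero]
    calc ‖∑ l ∈ Finset.univ.erase k, R j l • (z l - z k)‖
        ≤ ∑ l ∈ Finset.univ.erase k, R j l * D := by
          refine (norm_sum_le _ _).trans (Finset.sum_le_sum fun l _ => ?_)
          rw [norm_smul, Real.norm_of_nonneg (hR j l)]
          exact mul_le_mul_of_nonneg_left (hD l k) (hR j l)
      _ = (1 - R j k) * D := by
          rw [← Finset.sum_mul, ← hsum j, ← Finset.sum_erase_add _ _ (Finset.mem_univ k)]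
          ring
      _ ≤ (1 - α) * D := by
          have := hα j k
          gcongr
  rw [key]
  calc ‖∑ k, R i k • (z k - ∑ l, R j l • z l)‖
      ≤ ∑ k, R i k * ((1 - α) * D) := by
        refine (norm_sum_le _ _).trans (Finset.sum_le_sum fun k _ => ?_)
        rw [norm_smul, Real.norm_of_nonneg (hR i k)]
        exact mul_le_mul_of_nonneg_left (inner_bound k) (hR i k)
    _ = (1 - α) * D := by rw [← Finset.sum_mul, hsum, one_mul]

/-- The product `W (k - 1) * ⋯ * W 0`. -/
def backwardProduct [DecidableEq ι] (W : ℕ → Matrix ι ι ℝ) : ℕ → Matrix ι ι ℝ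
  | 0 => 1
  | k + 1 => W k * backwardProduct W k

section BackwardProduct

variable [DecidableEq ι] {W : ℕ → Matrix ι ι ℝ}

theorem backwardProduct_nonneg (hW : ∀ t i j, 0 ≤ W t i j) (k : ℕ) (i j : ι) :
    0 ≤ backwardProduct W k i j := by
  induction k generalizing i with
  | zero =>
    rw [backwardProduct, Matrix.one_apply]
    split_ifs <;> norm_num
  | succ k ih =>
    rw [backwardProduct, Matrix.mul_apply]
    exact Finset.sum_nonneg fun l _ => mul_nonneg (hW _ _ _) (ih l)

theorem backwardProduct_row_sum (hsum : ∀ t i, ∑ j, W t i j = 1) (k : ℕ) (i : ι) :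
    ∑ j, backwardProduct W k i j = 1 := by
  induction k generalizing i with
  | zero => simp [backwardProduct, Matrix.one_apply]
  | succ k ih =>
    simp only [backwardProduct, Matrix.mul_apply]
    rw [Finset.sum_comm]
    simp only [← Finset.mul_sum, ih, mul_one, hsum]

theorem eq_sum_backwardProduct_smul {z : ℕ → ι → V}
    (hz : ∀ t i, z (t + 1) i = ∑ j, W t i j • z t j) (k : ℕ) (i : ι) :
    z k i = ∑ j, backwardProduct W k i j • z 0 j := by
  induction k generalizing i with
  | zero => simp [backwardProduct, Matrix.one_apply]
  | succ k ih =>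
    rw [hz]
    simp only [backwardProduct, Matrix.mul_apply, Finset.sum_smul, ih, Finset.smul_sum, smul_smul]
    exact Finset.sum_comm

theorem le_backwardProduct_succ {c : ℝ} (hc : 0 ≤ c) (hW : ∀ t i j, 0 ≤ W t i j) {k : ℕ}
    {i j l : ι} (h : c ≤ W k i l) (hl : c ^ k ≤ backwardProduct W k l j) :
    c ^ (k + 1) ≤ backwardProduct W (k + 1) i j := by
  rw [backwardProduct, Matrix.mul_apply, pow_succ']
  calc c * c ^ k ≤ W k i l * backwardProduct W k l j :=
        mul_le_mul h hl (pow_nonneg hc k) (hc.trans h)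
    _ ≤ _ := Finset.single_le_sum (f := fun l => W k i l * backwardProduct W k l j)
        (fun m _ => mul_nonneg (hW _ _ _) (backwardProduct_nonneg hW k m j)) (Finset.mem_univ l)

/-- A walk of length `k` contributes to the entry a product of `k` weights, each at least `c`. -/
theorem le_backwardProduct_of_walk {A : Matrix ι ι ℕ} {c : ℝ} (hc : 0 ≤ c)
    (hW : ∀ t i j, 0 ≤ W t i j) (hA : ∀ t i j, 0 < A i j → c ≤ W t i j) {k : ℕ} {i j : ι}
    (h : 0 < (A ^ k) i j) : c ^ k ≤ backwardProduct W k i j := by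
  induction k generalizing i with
  | zero =>
    rw [pow_zero, Matrix.one_apply] at h
    split_ifs at h with hij
    · simp [backwardProduct, Matrix.one_apply, hij]
    · exact absurd h (lt_irrefl 0)
  | succ k ih =>
    rw [pow_succ', Matrix.mul_apply] at h
    obtain ⟨l, -, hl⟩ := Finset.exists_ne_zero_of_sum_ne_zero h.ne'
    obtain ⟨h1, h2⟩ := Nat.mul_ne_zero_iff.1 hl
    exact le_backwardProduct_succ hc hW (hA k i l (Nat.pos_of_ne_zero h1))
      (ih (Nat.pos_of_ne_zero h2))

/-- Loops lengthen a walk without moving its ends, so walks between different pairs can be given one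
common length. -/
theorem le_backwardProduct_of_le {c : ℝ} (hc : 0 ≤ c) (hW : ∀ t i j, 0 ≤ W t i j)
    (hdiag : ∀ t i, c ≤ W t i i) {k m : ℕ} (hkm : k ≤ m) {i j : ι}
    (h : c ^ k ≤ backwardProduct W k i j) : c ^ m ≤ backwardProduct W m i j := by
  induction m, hkm using Nat.le_induction with
  | base => exact h
  | succ m _ ih => exact le_backwardProduct_succ hc hW (hdiag m i) ih

end BackwardProduct

end Averaging

/-- Repeated averaging along an irreducible graph with loops, with weights bounded below, contracts
the diameter geometrically; the rate depends only on the graph and the bound. -/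
theorem exists_geometric_decay {n : ℕ} {A : Matrix (Fin n) (Fin n) ℕ} (hA : IsIrreducible A)
    {c : ℝ} (hc : 0 < c) (hc2 : c ≤ 1 / 2) :
    ∃ K r : ℝ, 0 < K ∧ 0 < r ∧ r < 1 ∧
      ∀ {V : Type} [NormedAddCommGroup V] [NormedSpace ℝ V] (W : ℕ → Matrix (Fin n) (Fin n) ℝ)
        (z : ℕ → Fin n → V) (D : ℝ), (∀ t i j, 0 ≤ W t i j) → (∀ t i, ∑ j, W t i j = 1) →
        (∀ t i j, 0 < A i j → c ≤ W t i j) → (∀ t i, c ≤ W t i i) →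
        (∀ t i, z (t + 1) i = ∑ j, W t i j • z t j) → (∀ i j, ‖z 0 i - z 0 j‖ ≤ D) →
        ∀ t i j, ‖z t i - z t j‖ ≤ K * D * r ^ t := by
  choose k hk using hA
  obtain ⟨N, hN1, hN⟩ : ∃ N : ℕ, 1 ≤ N ∧ ∀ i j, k i j ≤ N :=
    ⟨1 + ∑ i, ∑ j, k i j, by omega, fun i j => by
      have h1 : k i j ≤ ∑ j, k i j :=
        Finset.single_le_sum (f := fun j => k i j) (fun _ _ => Nat.zero_le _) (Finset.mem_univ j)
      have h2 : ∑ j, k i j ≤ ∑ i, ∑ j, k i j :=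
        Finset.single_le_sum (f := fun i => ∑ j, k i j) (fun _ _ => Nat.zero_le _)
          (Finset.mem_univ i)
      omega⟩
  have hNr : (1 : ℝ) ≤ N := by exact_mod_cast hN1
  set α : ℝ := c ^ N with hαdef
  have hα : 0 < α := pow_pos hc N
  have hα2 : α ≤ 1 / 2 := by
    calc c ^ N ≤ c ^ 1 := pow_le_pow_of_le_one hc.le (by linarith) hN1
      _ ≤ 1 / 2 := by rwa [pow_one]
  have hαN : α / N ≤ α := div_le_self hα.le hNr
  have hαN0 : 0 < α / N := by positivity
  -- Bernoulli's inequality gives `1 - α ≤ r ^ N`: one block of `N` steps contracts at least as well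
  -- as the rate `r` demands.
  set r : ℝ := 1 - α / N with hr
  have hr2 : 1 / 2 ≤ r := by linarith
  have hrN : 1 - α ≤ r ^ N := by
    have := one_add_mul_le_pow (a := -(α / N)) (by linarith) N
    have h2 : (N : ℝ) * -(α / N) = -α := by field_simp
    rw [h2, ← sub_eq_add_neg, ← sub_eq_add_neg] at this
    exact this
  -- The factor `2 ^ N` covers the incomplete first block: `r ≥ 1 / 2` makes `2 ^ N * r ^ t ≥ 1` for
  -- `t < N`.
  refine ⟨2 ^ N, r, by positivity, by linarith, by linarith, ?_⟩
  intro V _ _ W z D hW hsum hAW hdiag hz hD t i j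
  have hD0 : 0 ≤ D := (norm_nonneg _).trans (hD i i)
  have one_step : ∀ t, ∀ i j, ‖z t i - z t j‖ ≤ D := by
    intro t
    induction t with
    | zero => exact hD
    | succ t ih =>
      intro i j
      rw [hz, hz]
      -- The case `α = 0`: averaging never increases the diameter.
      simpa using norm_average_sub_average_le (hW t) (hsum t) (hW t) ih i j
  induction t using Nat.strong_induction_on generalizing i j with
  | _ t ih =>
    rcases lt_or_ge t N with ht | ht
    · refine (one_step t i j).trans ?_
      have h1 : (1 : ℝ) ≤ 2 ^ N * r ^ t := by
        calc (1 : ℝ) = 2 ^ t * (1 / 2) ^ t := by rw [← mul_pow]; norm_num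
          _ ≤ 2 ^ N * r ^ t := by gcongr; norm_num
      calc D = 1 * D := (one_mul D).symm
        _ ≤ 2 ^ N * r ^ t * D := by gcongr
        _ = 2 ^ N * D * r ^ t := by ring
    · obtain ⟨u, rfl⟩ := Nat.exists_eq_add_of_le' ht
      have hzu : ∀ s i, z (u + (s + 1)) i = ∑ j, W (u + s) i j • z (u + s) j :=
        fun s i => hz (u + s) i
      have e1 := eq_sum_backwardProduct_smul (W := fun s => W (u + s)) (z := fun s => z (u + s)) hzu
      have e2 : ∀ i j, α ≤ backwardProduct (fun s => W (u + s)) N i j := fun i j =>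
        le_backwardProduct_of_le hc.le (fun t => hW (u + t)) (fun t => hdiag (u + t)) (hN i j)
          (le_backwardProduct_of_walk hc.le (fun t => hW (u + t)) (fun t => hAW (u + t)) (hk i j))
      have e3 := norm_average_sub_average_le (z := z u)
        (backwardProduct_nonneg (fun t => hW (u + t)) N)
        (backwardProduct_row_sum (fun t => hsum (u + t)) N) e2 (ih u (by omega)) i j
      have e4 := e1 N i
      have e5 := e1 N j
      simp only [add_zero] at e4 e5
      rw [e4, e5]
      refine e3.trans ?_
      rw [pow_add]
      have : (1 - α) * (2 ^ N * D * r ^ u) ≤ r ^ N * (2 ^ N * D * r ^ u) := by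
        have : 0 ≤ r := by linarith
        gcongr
      linarith

/-! ### The consensus dynamics and its contraction. -/

variable {n d : ℕ}

theorem norm_coe_sphere (x : Sphere d) : ‖(x : E d)‖ = 1 := mem_sphere_zero_iff_norm.1 x.2

theorem inner_sphere_le_one (x y : Sphere d) : inner ℝ (x : E d) (y : E d) ≤ 1 := by
  simpa [norm_coe_sphere] using real_inner_le_norm (x : E d) (y : E d)

/-- The unnormalized update of agent `i` when every agent attracts every other one. -/
def pull (η : Fin n → Fin n → ℝ) (Y : Config n d) (i : Fin n) : E d :=
  (Y i : E d) + ∑ j, η i j • (Y j : E d)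

open Classical in
/-- One step of the dynamics without repulsion. -/
def consensus (η : Fin n → Fin n → ℝ) (Y : Config n d) : Config n d :=
  fun i =>
    if h : pull η Y i = 0 then Y i
    else ⟨‖pull η Y i‖⁻¹ • pull η Y i, by
      rw [mem_sphere_zero_iff_norm, norm_smul, norm_inv, norm_norm,
        inv_mul_cancel₀ (norm_ne_zero_iff.mpr h)]⟩

section Consensus

variable {η : Fin n → Fin n → ℝ}

theorem inner_pull (Y : Config n d) (i : Fin n) (v : E d) :
    inner ℝ (pull η Y i) v = inner ℝ (Y i : E d) v + ∑ j, η i j * inner ℝ (Y j : E d) v := by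
  simp only [pull, inner_add_left, sum_inner, real_inner_smul_left]

theorem le_inner_pull (hη : ∀ i j, 0 ≤ η i j) {Y : Config n d} {v : E d} {ε : ℝ}
    (h : ∀ j, ε ≤ inner ℝ (Y j : E d) v) (i : Fin n) :
    ε * (1 + ∑ j, η i j) ≤ inner ℝ (pull η Y i) v := by
  rw [inner_pull, mul_add, mul_one, Finset.mul_sum]
  refine add_le_add (h i) (Finset.sum_le_sum fun j _ => ?_)
  rw [mul_comm]
  exact mul_le_mul_of_nonneg_left (h j) (hη i j)

theorem norm_pull_le (hη : ∀ i j, 0 ≤ η i j) (Y : Config n d) (i : Fin n) :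
    ‖pull η Y i‖ ≤ 1 + ∑ j, η i j := by
  refine (norm_add_le _ _).trans (add_le_add (norm_coe_sphere _).le
    ((norm_sum_le _ _).trans (Finset.sum_le_sum fun j _ => ?_)))
  rw [norm_smul, norm_coe_sphere, mul_one, Real.norm_of_nonneg (hη i j)]

theorem one_le_one_add_sum (hη : ∀ i j, 0 ≤ η i j) (i : Fin n) : 1 ≤ 1 + ∑ j, η i j :=
  le_add_of_nonneg_right (Finset.sum_nonneg fun j _ => hη i j)

theorem inner_pull_pos (hη : ∀ i j, 0 ≤ η i j) {Y : Config n d} {v : E d}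
    (h : ∀ j, 0 < inner ℝ (Y j : E d) v) (i : Fin n) : 0 < inner ℝ (pull η Y i) v := by
  rw [inner_pull]
  exact add_pos_of_pos_of_nonneg (h i) (Finset.sum_nonneg fun j _ => mul_nonneg (hη i j) (h j).le)

theorem ne_zero_of_inner_pos {u v : E d} (h : 0 < inner ℝ u v) : u ≠ 0 := by
  rintro rfl
  simp at h

theorem coe_consensus {Y : Config n d} {i : Fin n} (h : pull η Y i ≠ 0) :
    (consensus η Y i : E d) = ‖pull η Y i‖⁻¹ • pull η Y i := by
  simp [consensus, h]

theorem inner_consensus_pos (hη : ∀ i j, 0 ≤ η i j) {Y : Config n d} {v : E d}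
    (h : ∀ j, 0 < inner ℝ (Y j : E d) v) (i : Fin n) :
    0 < inner ℝ (consensus η Y i : E d) v := by
  have h1 := inner_pull_pos hη h i
  have h2 := ne_zero_of_inner_pos h1
  rw [coe_consensus h2, real_inner_smul_left]
  have := norm_pos_iff.2 h2
  positivity

/-- Normalizing divides by at most `1 + ∑ j, η i j`, the same factor by which the lower bound on the
inner product grows. Hence caps are forward invariant. -/
theorem le_inner_consensus (hη : ∀ i j, 0 ≤ η i j) {Y : Config n d} {v : E d} {ε : ℝ} (hε : 0 < ε)
    (h : ∀ j, ε ≤ inner ℝ (Y j : E d) v) (i : Fin n) :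
    ε ≤ inner ℝ (consensus η Y i : E d) v := by
  have h2 := ne_zero_of_inner_pos (inner_pull_pos hη (fun j => hε.trans_le (h j)) i)
  rw [coe_consensus h2, real_inner_smul_left, inv_mul_eq_div, le_div_iff₀ (norm_pos_iff.2 h2)]
  exact (mul_le_mul_of_nonneg_left (norm_pull_le hη Y i) hε.le).trans (le_inner_pull hη h i)

theorem inner_iterate_consensus_pos (hη : ∀ i j, 0 ≤ η i j) {Y : Config n d} {v : E d}
    (h : ∀ j, 0 < inner ℝ (Y j : E d) v) (t : ℕ) (i : Fin n) :
    0 < inner ℝ ((consensus η)^[t] Y i : E d) v := by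
  induction t generalizing i with
  | zero => exact h i
  | succ t ih =>
    rw [Function.iterate_succ_apply']
    exact inner_consensus_pos hη ih i

theorem le_inner_iterate_consensus (hη : ∀ i j, 0 ≤ η i j) {Y : Config n d} {v : E d} {ε : ℝ}
    (hε : 0 < ε) (h : ∀ j, ε ≤ inner ℝ (Y j : E d) v) (t : ℕ) (i : Fin n) :
    ε ≤ inner ℝ ((consensus η)^[t] Y i : E d) v := by
  induction t generalizing i with
  | zero => exact h i
  | succ t ih =>
    rw [Function.iterate_succ_apply']
    exact le_inner_consensus hη hε ih i

/-- The central projection of the opinions to the hyperplane `⟪·, v⟫ = 1`. -/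
def centralProjection (v : E d) (Y : Config n d) (i : Fin n) : E d :=
  (inner ℝ (Y i : E d) v)⁻¹ • (Y i : E d)

/-- In the central projection, a consensus step averages with these weights. -/
def consensusWeight (η : Fin n → Fin n → ℝ) (v : E d) (Y : Config n d) :
    Matrix (Fin n) (Fin n) ℝ :=
  fun i j => ((if i = j then 1 else 0) + η i j) * inner ℝ (Y j : E d) v / inner ℝ (pull η Y i) v

theorem consensusWeight_nonneg (hη : ∀ i j, 0 ≤ η i j) {Y : Config n d} {v : E d}
    (h : ∀ j, 0 < inner ℝ (Y j : E d) v) (i j : Fin n) : 0 ≤ consensusWeight η v Y i j := by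
  refine div_nonneg (mul_nonneg (add_nonneg ?_ (hη i j)) (h j).le) (inner_pull_pos hη h i).le
  split_ifs <;> norm_num

theorem consensusWeight_sum (hη : ∀ i j, 0 ≤ η i j) {Y : Config n d} {v : E d}
    (h : ∀ j, 0 < inner ℝ (Y j : E d) v) (i : Fin n) : ∑ j, consensusWeight η v Y i j = 1 := by
  simp only [consensusWeight]
  rw [← Finset.sum_div, div_eq_one_iff_eq (inner_pull_pos hη h i).ne', inner_pull]
  simp only [add_mul, Finset.sum_add_distrib, ite_mul, one_mul, zero_mul, Finset.sum_ite_eq,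
    Finset.mem_univ, if_true]

theorem le_consensusWeight (hη : ∀ i j, 0 ≤ η i j) {Y : Config n d} {e : Sphere d} {ε c : ℝ}
    (hε : 0 < ε) (h : ∀ j, ε ≤ inner ℝ (Y j : E d) (e : E d)) (i j : Fin n)
    (hc : c ≤ ((if i = j then 1 else 0) + η i j) * ε / (1 + ∑ k, η i k)) :
    c ≤ consensusWeight η (e : E d) Y i j := by
  refine hc.trans ?_
  have h0 : 0 ≤ (if i = j then 1 else 0) + η i j := by
    refine add_nonneg ?_ (hη i j)
    split_ifs <;> norm_num
  have h1 := inner_pull_pos hη (fun j => hε.trans_le (h j)) i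
  have h2 : inner ℝ (pull η Y i) (e : E d) ≤ 1 + ∑ k, η i k := by
    refine (real_inner_le_norm _ _).trans ?_
    rw [norm_coe_sphere, mul_one]
    exact norm_pull_le hη Y i
  exact div_le_div₀ (mul_nonneg h0 (hε.le.trans (h j))) (mul_le_mul_of_nonneg_left (h j) h0) h1 h2

/-- Central projection ignores positive scaling, so the normalization drops out and only the linear
map `pull` remains. -/
theorem centralProjection_consensus (hη : ∀ i j, 0 ≤ η i j) {Y : Config n d} {v : E d}
    (h : ∀ j, 0 < inner ℝ (Y j : E d) v) (i : Fin n) :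
    centralProjection v (consensus η Y) i =
      ∑ j, consensusWeight η v Y i j • centralProjection v Y j := by
  have h1 := inner_pull_pos hη h i
  have h2 := ne_zero_of_inner_pos h1
  have h3 := norm_pos_iff.2 h2
  have e1 : centralProjection v (consensus η Y) i = (inner ℝ (pull η Y i) v)⁻¹ • pull η Y i := by
    rw [centralProjection, coe_consensus h2, real_inner_smul_left, smul_smul]
    congr 1
    field_simp
  have e2 : ∀ j, consensusWeight η v Y i j • centralProjection v Y j =
      (inner ℝ (pull η Y i) v)⁻¹ • (((if i = j then 1 else 0) + η i j) • (Y j : E d)) := by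
    intro j
    have := (h j).ne'
    rw [consensusWeight, centralProjection, smul_smul, smul_smul]
    congr 1
    field_simp
  rw [e1, Finset.sum_congr rfl fun j _ => e2 j, ← Finset.smul_sum]
  congr 1
  simp only [pull, add_smul, Finset.sum_add_distrib, ite_smul, one_smul, zero_smul,
    Finset.sum_ite_eq, Finset.mem_univ, if_true]

theorem norm_centralProjection_mul {Y : Config n d} {v : E d}
    (h : ∀ j, 0 < inner ℝ (Y j : E d) v) (i : Fin n) :
    ‖centralProjection v Y i‖ = (inner ℝ (Y i : E d) v)⁻¹ := by
  rw [centralProjection, norm_smul, norm_coe_sphere, mul_one, norm_inv, Real.norm_of_nonneg (h i).le]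

/-- With heights `a`, `b` and projections `z i`, `z j`, the difference is `a • (z i - z j) + (a - b)
• z j`. The projections have norms `1 / a` and `1 / b`, so the reverse triangle inequality bounds
the second term by `a * ‖z i - z j‖` too, and `a ≤ 1`. -/
theorem norm_sub_le_centralProjection {Y : Config n d} {e : Sphere d}
    (h : ∀ j, 0 < inner ℝ (Y j : E d) (e : E d)) (i j : Fin n) :
    ‖(Y i : E d) - (Y j : E d)‖ ≤
      2 * ‖centralProjection (e : E d) Y i - centralProjection (e : E d) Y j‖ := by
  set z := centralProjection (e : E d) Y with hz
  have hai := h i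
  have haj := h j
  have ha1 := inner_sphere_le_one (Y i) e
  have ni := norm_centralProjection_mul h i
  have nj := norm_centralProjection_mul h j
  rw [← hz] at ni nj
  have yi : (Y i : E d) = inner ℝ (Y i : E d) (e : E d) • z i := by
    rw [hz, centralProjection, smul_smul, mul_inv_cancel₀ hai.ne', one_smul]
  have yj : (Y j : E d) = inner ℝ (Y j : E d) (e : E d) • z j := by
    rw [hz, centralProjection, smul_smul, mul_inv_cancel₀ haj.ne', one_smul]
  set a := inner ℝ (Y i : E d) (e : E d)
  set b := inner ℝ (Y j : E d) (e : E d)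
  have e1 : (Y i : E d) - (Y j : E d) = a • (z i - z j) + (a - b) • z j := by
    rw [yi, yj]
    module
  have e2 : |a - b| * b⁻¹ ≤ a * ‖z i - z j‖ := by
    have h1 : (a - b) * b⁻¹ = a * (‖z j‖ - ‖z i‖) := by
      rw [ni, nj]
      field_simp
    rw [← abs_of_pos (inv_pos.2 haj), ← abs_mul, h1, abs_mul, abs_of_pos hai]
    gcongr
    rw [norm_sub_rev]
    exact abs_norm_sub_norm_le _ _
  calc ‖(Y i : E d) - (Y j : E d)‖ ≤ a * ‖z i - z j‖ + |a - b| * b⁻¹ := by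
        rw [e1]
        refine (norm_add_le _ _).trans ?_
        rw [norm_smul, norm_smul, nj, Real.norm_of_nonneg hai.le, Real.norm_eq_abs]
    _ ≤ 2 * (a * ‖z i - z j‖) := by linarith
    _ ≤ 2 * (1 * ‖z i - z j‖) := by gcongr
    _ = _ := by rw [one_mul]

theorem exists_pos_forall_le_of_finite {ι : Type*} [Finite ι] (f : ι → ℝ) :
    ∃ c : ℝ, 0 < c ∧ c ≤ 1 / 2 ∧ ∀ i, 0 < f i → c ≤ f i := by
  have h : ∀ᶠ c in 𝓝[>] (0 : ℝ), ∀ i, 0 < f i → c ≤ f i := by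
    refine eventually_all.2 fun i => ?_
    by_cases hi : 0 < f i
    · filter_upwards [Ioo_mem_nhdsGT hi] with c hc _ using hc.2.le
    · exact Eventually.of_forall fun c hc => absurd hc hi
  obtain ⟨c, hc, h1, h2⟩ :=
    (h.and (Ioo_mem_nhdsGT (show (0 : ℝ) < 1 / 2 by norm_num))).exists
  exact ⟨c, h1, h2.le, hc⟩

/-- Opinions in a common spherical cap smaller than a hemisphere approach each other geometrically
under the consensus dynamics, at a rate depending only on the cap and the influences. -/
theorem exists_consensus_contraction (hη : ∀ i j, 0 ≤ η i j)
    (hA : IsIrreducible (influenceMatrix η)) {ε : ℝ} (hε : 0 < ε) :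
    ∃ K r : ℝ, 0 < K ∧ 0 < r ∧ r < 1 ∧ ∀ (Y : Config n d) (e : Sphere d),
      (∀ i, ε ≤ inner ℝ (Y i : E d) (e : E d)) → ∀ t i j,
        ‖((consensus η)^[t] Y i : E d) - ((consensus η)^[t] Y j : E d)‖ ≤ K * r ^ t := by
  obtain ⟨c, hc, hc2, hcle⟩ := exists_pos_forall_le_of_finite fun p : Fin n × Fin n =>
    ((if p.1 = p.2 then 1 else 0) + η p.1 p.2) * ε / (1 + ∑ k, η p.1 k)
  obtain ⟨K, r, hK, hr, hr1, hdecay⟩ := exists_geometric_decay hA hc hc2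
  -- Projected opinions have norm at most `ε⁻¹`, hence initial diameter at most `2 * ε⁻¹`; the outer
  -- `2` is the cost of returning to the sphere.
  refine ⟨2 * (K * (2 * ε⁻¹)), r, by positivity, hr, hr1, fun Y e hY t i j => ?_⟩
  have hcap := le_inner_iterate_consensus hη hε hY
  have hpos := fun t i => hε.trans_le (hcap t i)
  have hsum := fun i => zero_lt_one.trans_le (one_le_one_add_sum hη i)
  have key := hdecay (fun t => consensusWeight η (e : E d) ((consensus η)^[t] Y))
    (fun t => centralProjection (e : E d) ((consensus η)^[t] Y)) (2 * ε⁻¹)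
    (fun t => consensusWeight_nonneg hη (hpos t)) (fun t => consensusWeight_sum hη (hpos t))
    (fun t i j hij => by
      have hij' : 0 < η i j := by
        by_contra hneg
        simp [influenceMatrix, hneg] at hij
      refine le_consensusWeight hη hε (hcap t) i j (hcle (i, j) ?_)
      refine div_pos (mul_pos (add_pos_of_nonneg_of_pos ?_ hij') hε) (hsum i)
      dsimp only
      split_ifs <;> norm_num)
    (fun t i => by
      refine le_consensusWeight hη hε (hcap t) i i (hcle (i, i) ?_)
      refine div_pos (mul_pos (add_pos_of_pos_of_nonneg ?_ (hη i i)) hε) (hsum i)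
      simp)
    (fun t i => by
      rw [Function.iterate_succ_apply']
      exact centralProjection_consensus hη (hpos t) i)
    (fun i j => by
      refine (norm_sub_le _ _).trans ?_
      rw [norm_centralProjection_mul (hpos 0), norm_centralProjection_mul (hpos 0), two_mul]
      exact add_le_add (inv_anti₀ hε (hcap 0 i)) (inv_anti₀ hε (hcap 0 j)))
    t i j
  refine (norm_sub_le_centralProjection (hpos t) i j).trans ?_
  rw [mul_assoc]
  exact mul_le_mul_of_nonneg_left key zero_le_two

end Consensus

/-! ### Sign flips: from the party model to consensus. -/

section Flip

/-- Replace the opinion of each agent `i` with `s i = -1` by its antipode. -/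
def flip (s : Fin n → ℤˣ) (Y : Config n d) : Config n d :=
  fun i => ⟨((s i : ℤ) : ℝ) • (Y i : E d), by
    rcases Int.units_eq_one_or (s i) with h | h <;> simp [h]⟩

theorem coe_flip (s : Fin n → ℤˣ) (Y : Config n d) (i : Fin n) :
    (flip s Y i : E d) = ((s i : ℤ) : ℝ) • (Y i : E d) := rfl

theorem flip_flip (s : Fin n → ℤˣ) (Y : Config n d) : flip s (flip s Y) = Y := by
  funext i
  apply Subtype.ext
  rw [coe_flip, coe_flip]
  rcases Int.units_eq_one_or (s i) with h | h <;> simp [h]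

/-- All opinions lie strictly on the same side of the hyperplane orthogonal to `ξ`. -/
def SameSide (Y : Config n d) (ξ : Sphere d) : Prop :=
  (∀ i, 0 < inner ℝ (Y i : E d) (ξ : E d)) ∨ ∀ i, inner ℝ (Y i : E d) (ξ : E d) < 0

theorem sign_inner_flip_eq_iff {s : Fin n → ℤˣ} {Y : Config n d} {ξ : Sphere d}
    (h : SameSide Y ξ) (i j : Fin n) :
    SignType.sign (inner ℝ (flip s Y j : E d) (ξ : E d)) =
      SignType.sign (inner ℝ (flip s Y i : E d) (ξ : E d)) ↔ s j = s i := by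
  simp only [coe_flip, real_inner_smul_left]
  rcases h with h | h <;> rcases Int.units_eq_one_or (s i) with hi | hi <;>
    rcases Int.units_eq_one_or (s j) with hj | hj <;>
    simp [hi, hj, h i, h j, sign_pos, sign_neg]

/-- If `s j = s i`, agent `j` attracts with sign `s i`; otherwise the minus sign of the repulsion
cancels against `s j = -s i`. Either way the summand carries the factor `s i`. -/
theorem unnormalizedUpdate_flip {η : Fin n → Fin n → ℝ} {s : Fin n → ℤˣ} {Y : Config n d}
    {ξ : Sphere d} (h : SameSide Y ξ) (i : Fin n) :
    unnormalizedUpdate η ξ (flip s Y) i = ((s i : ℤ) : ℝ) • pull η Y i := by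
  classical
  rw [unnormalizedUpdate, pull, smul_add, Finset.smul_sum, ← coe_flip, add_right_inj]
  rw [Finset.sum_filter, Finset.sum_filter, ← Finset.sum_sub_distrib]
  refine Finset.sum_congr rfl fun j _ => ?_
  have hiff := sign_inner_flip_eq_iff (s := s) h i j
  by_cases hs : s j = s i
  · rw [if_pos (hiff.2 hs), if_neg (not_not.2 (hiff.2 hs)), sub_zero, coe_flip, hs, smul_comm]
  · have hneg : s j = -s i := by
      rcases Int.units_eq_one_or (s i) with hi | hi <;>
        rcases Int.units_eq_one_or (s j) with hj | hj <;> simp_all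
    rw [if_neg (mt hiff.1 hs), if_pos (mt hiff.1 hs), zero_sub, coe_flip, hneg, smul_comm]
    push_cast
    rw [neg_smul, neg_neg]

/-- As long as `ξ` does not separate the opinions up to sign, a step of the party model is a step of
the consensus dynamics up to sign. -/
theorem step_flip {η : Fin n → Fin n → ℝ} {s : Fin n → ℤˣ} {Y : Config n d}
    {ξ : Sphere d} (h : SameSide Y ξ) : step η ξ (flip s Y) = flip s (consensus η Y) := by
  funext i
  apply Subtype.ext
  have hu := unnormalizedUpdate_flip (η := η) (s := s) h i
  rw [coe_flip]
  by_cases h0 : pull η Y i = 0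
  · simp [step, hu, consensus, h0, coe_flip]
  · rw [coe_consensus h0]
    rcases Int.units_eq_one_or (s i) with hi | hi <;> simp [step, hu, h0, hi]

theorem trajectory_flip {η : Fin n → Fin n → ℝ} {s : Fin n → ℤˣ} {Y : Config n d}
    {ξ : ℕ → Sphere d} (h : ∀ t, SameSide ((consensus η)^[t] Y) (ξ t)) (t : ℕ) :
    trajectory η (flip s Y) ξ t = flip s ((consensus η)^[t] Y) := by
  induction t with
  | zero => rfl
  | succ t ih => rw [trajectory, ih, step_flip (h t), Function.iterate_succ_apply']

/-- The comparison point moves every agent to the opinion of agent `0`, with the same signs; `hn`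
provides this agent. -/
theorem infDist_flip_le (hn : 1 ≤ n) (s : Fin n → ℤˣ) {Y : Config n d} {D : ℝ}
    (hD : ∀ i j, ‖(Y i : E d) - (Y j : E d)‖ ≤ D) :
    Metric.infDist (flip s Y).toEuclidean (polarizedSet n d) ≤ Real.sqrt n * D := by
  let i₀ : Fin n := ⟨0, hn⟩
  have hD0 : 0 ≤ D := (norm_nonneg _).trans (hD i₀ i₀)
  have hmem : (flip s fun _ => Y i₀).toEuclidean ∈ polarizedSet n d :=
    Set.mem_iUnion.2 ⟨s, Y i₀, fun i => rfl⟩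
  refine (Metric.infDist_le_dist_of_mem hmem).trans ?_
  rw [PiLp.dist_eq_of_L2]
  have hi : ∀ i, dist ((flip s Y).toEuclidean i) ((flip s fun _ => Y i₀).toEuclidean i) ≤ D := by
    intro i
    refine le_trans (le_of_eq ?_) (hD i i₀)
    change dist (((s i : ℤ) : ℝ) • (Y i : E d)) (((s i : ℤ) : ℝ) • (Y i₀ : E d)) = _
    rw [dist_eq_norm, ← smul_sub]
    rcases Int.units_eq_one_or (s i) with h | h <;> simp [h, norm_sub_rev]
  calc _ ≤ Real.sqrt (∑ _i : Fin n, D ^ 2) := by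
        apply Real.sqrt_le_sqrt
        gcongr with i
        exact hi i
    _ = Real.sqrt n * D := by
        rw [Finset.sum_const, Finset.card_univ, Fintype.card_fin, nsmul_eq_mul,
          Real.sqrt_mul (Nat.cast_nonneg n), Real.sqrt_sq hD0]

end Flip

/-! ### Measure of slabs and caps. -/

section Slab

/-- The points of the sphere at distance at most `ε` from the hyperplane orthogonal to `x`. -/
def slab (x : E d) (ε : ℝ) : Set (Sphere d) := {ξ | |inner ℝ x (ξ : E d)| ≤ ε}

theorem measurableSet_slab (x : E d) (ε : ℝ) : MeasurableSet (slab x ε) :=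
  (isClosed_le (by fun_prop) continuous_const).measurableSet

/-- In an orthonormal basis containing `x`, the set lies in a box with half-width `ε` along `x` and
`1` along the other axes. -/
theorem volume_slab_inter_ball_le (x : Sphere d) (ε : ℝ) :
    volume {y : E d | ‖y‖ ≤ 1 ∧ |inner ℝ (x : E d) y| ≤ ε} ≤ 2 ^ d * ENNReal.ofReal ε := by
  have hd : 0 < d := by
    rcases Nat.eq_zero_or_pos d with rfl | h
    · have := norm_coe_sphere x
      rw [Subsingleton.elim (x : E 0) 0] at this
      simp at this
    · exact h
  let i₀ : Fin d := ⟨0, hd⟩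
  obtain ⟨b, hb⟩ := Orthonormal.exists_orthonormalBasis_extension_of_card_eq (𝕜 := ℝ) (E := E d)
    (ι := Fin d) (by simp) (v := fun _ => (x : E d)) (s := {i₀}) (by
      constructor
      · intro i
        exact norm_coe_sphere x
      · intro i j hij
        exact absurd (Subsingleton.elim i j) hij)
  have hb0 : b i₀ = x := hb i₀ rfl
  let w : Fin d → ℝ := fun i => if i = i₀ then ε else 1
  have hmp : MeasurePreserving (fun y : E d => WithLp.ofLp (b.repr y)) :=
    (PiLp.volume_preserving_ofLp (Fin d)).comp b.measurePreserving_repr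
  calc volume {y : E d | ‖y‖ ≤ 1 ∧ |inner ℝ (x : E d) y| ≤ ε}
      ≤ volume ((fun y : E d => WithLp.ofLp (b.repr y)) ⁻¹'
          Set.pi Set.univ fun i => Set.Icc (-w i) (w i)) := by
        refine measure_mono fun y hy i _ => ?_
        change b.repr y i ∈ Set.Icc (-w i) (w i)
        rw [Set.mem_Icc, ← abs_le, b.repr_apply_apply]
        by_cases hi : i = i₀
        · simp only [w, hi, if_true, hb0]
          exact hy.2
        · simp only [w, hi, if_false]
          refine (abs_real_inner_le_norm _ _).trans ?_
          rw [b.norm_eq_one, one_mul]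
          exact hy.1
    _ = ∏ i, ENNReal.ofReal (w i - -w i) := by
        rw [hmp.measure_preimage (MeasurableSet.univ_pi fun i => measurableSet_Icc).nullMeasurableSet,
          volume_pi_pi]
        simp only [Real.volume_Icc]
    _ = ∏ i, 2 * ENNReal.ofReal (w i) := by
        refine Finset.prod_congr rfl fun i _ => ?_
        rw [sub_neg_eq_add, ← two_mul, ENNReal.ofReal_mul zero_le_two, ENNReal.ofReal_ofNat]
    _ = 2 ^ d * ENNReal.ofReal ε := by
        rw [Finset.prod_mul_distrib, Finset.prod_const, Finset.card_univ, Fintype.card_fin]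
        congr 1
        rw [Finset.prod_eq_single i₀]
        · simp [w]
        · intro i _ hi
          simp [w, hi]
        · simp

open scoped Pointwise in
-- Surface measure is `d` times the volume of the cone over the set, and shrinking a point towards
-- the origin keeps it in the slab.
theorem toSphere_slab_le (x : Sphere d) (ε : ℝ) :
    (volume : Measure (E d)).toSphere (slab (x : E d) ε) ≤ d * (2 ^ d * ENNReal.ofReal ε) := by
  rw [Measure.toSphere_apply' _ (measurableSet_slab _ _), finrank_euclideanSpace_fin]
  gcongr
  refine (measure_mono ?_).trans (volume_slab_inter_ball_le x ε)
  rintro _ ⟨a, ha, _, ⟨ξ, hξ, rfl⟩, rfl⟩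
  have hξ' : |inner ℝ (x : E d) (ξ : E d)| ≤ ε := hξ
  constructor
  · simp only [norm_smul, norm_coe_sphere, mul_one, Real.norm_of_nonneg ha.1.le]
    exact ha.2.le
  · simp only [real_inner_smul_right, abs_mul, abs_of_pos ha.1]
    exact (mul_le_of_le_one_left (abs_nonneg _) ha.2.le).trans hξ'

/-- A law with bounded density gives measure `O(ε)` to every slab of width `ε`. -/
theorem exists_measureReal_slab_le {𝒟 : Measure (Sphere d)} (h𝒟 : EquivalentToUniform 𝒟) :
    ∃ C : ℝ, 0 ≤ C ∧ ∀ (x : Sphere d) (ε : ℝ), 0 ≤ ε → 𝒟.real (slab (x : E d) ε) ≤ C * ε := by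
  obtain ⟨_, C', _, _, hC⟩ := h𝒟
  set m := (volume : Measure (E d)).toSphere Set.univ with hm
  refine ⟨((C' : ENNReal) * (m⁻¹ * (d * 2 ^ d))).toReal, ENNReal.toReal_nonneg,
    fun x ε hε => ?_⟩
  have hm0 : m ≠ 0 := by
    intro h0
    have : Nontrivial (E d) :=
      ⟨(x : E d), 0, fun hx => by simpa [hx] using norm_coe_sphere x⟩
    exact Measure.toSphere_ne_zero (volume : Measure (E d)) (Measure.measure_univ_eq_zero.1 h0)
  rw [measureReal_def, ← ENNReal.toReal_ofReal hε, ← ENNReal.toReal_mul, ENNReal.toReal_ofReal hε]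
  refine ENNReal.toReal_mono ?_ ?_
  · have : (2 : ENNReal) ^ d ≠ ⊤ := by simp
    finiteness
  · refine (hC _ (measurableSet_slab _ _)).2.trans ?_
    rw [uniformMeasure, Measure.smul_apply, smul_eq_mul, ← hm, mul_assoc, mul_assoc, mul_assoc]
    gcongr
    exact toSphere_slab_le x ε

/-- A direction separating nearby opinions is nearly orthogonal to one of them. -/
theorem not_sameSide_subset_iUnion_slab {Y : Config n d} {D : ℝ}
    (hD : ∀ i j, ‖(Y i : E d) - (Y j : E d)‖ ≤ D) :
    {ξ | ¬SameSide Y ξ} ⊆ ⋃ i, slab (Y i : E d) D := by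
  intro ξ hξ
  simp only [SameSide, Set.mem_ofPred_eq, not_or, not_forall, not_lt] at hξ
  obtain ⟨⟨i, hi⟩, ⟨j, hj⟩⟩ := hξ
  refine Set.mem_iUnion.2 ⟨i, ?_⟩
  have h1 := real_inner_le_norm ((Y j : E d) - (Y i : E d)) (ξ : E d)
  rw [norm_coe_sphere, mul_one, inner_sub_left] at h1
  have h2 := hD j i
  rw [slab, Set.mem_ofPred_eq, abs_of_nonpos hi]
  linarith

theorem measureReal_iUnion_slab_le {𝒟 : Measure (Sphere d)} {C : ℝ}
    (hC : ∀ (x : Sphere d) (ε : ℝ), 0 ≤ ε → 𝒟.real (slab (x : E d) ε) ≤ C * ε) (Y : Config n d)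
    {ε : ℝ} (hε : 0 ≤ ε) : 𝒟.real (⋃ i, slab (Y i : E d) ε) ≤ n * (C * ε) := by
  refine (measureReal_iUnion_fintype_le _).trans ((Finset.sum_le_sum fun i _ => hC (Y i) ε hε).trans ?_)
  simp

/-- The directions whose inner product with every opinion is at least `ε`. -/
def cap (Y : Config n d) (ε : ℝ) : Set (Sphere d) := {ξ | ∀ i, ε ≤ inner ℝ (Y i : E d) (ξ : E d)}

theorem measurableSet_cap (Y : Config n d) (ε : ℝ) : MeasurableSet (cap Y ε) := by
  simp only [cap, Set.ofPred_forall]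
  exact MeasurableSet.iInter fun i => (isClosed_le continuous_const (by fun_prop)).measurableSet

/-- After suitable sign flips, the opinions are in a common cap around many directions. -/
theorem exists_flip_cap {𝒟 : Measure (Sphere d)} [IsProbabilityMeasure 𝒟]
    (h𝒟 : EquivalentToUniform 𝒟) (n : ℕ) :
    ∃ ε b : ℝ, 0 < ε ∧ 0 < b ∧ ∀ X : Config n d, ∃ s : Fin n → ℤˣ, b ≤ 𝒟.real (cap (flip s X) ε) := by
  obtain ⟨C, hC0, hC⟩ := exists_measureReal_slab_le h𝒟
  have hN : (0 : ℝ) < Fintype.card (Fin n → ℤˣ) := by exact_mod_cast Fintype.card_pos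
  -- This `ε` gives the `n` slabs total mass at most `1 / 2`; some sign vector gets at least an
  -- equal share of the remaining half.
  refine ⟨1 / (2 * (n * C + 1)), 1 / (2 * Fintype.card (Fin n → ℤˣ)), by positivity, by positivity,
    fun X => ?_⟩
  set ε : ℝ := 1 / (2 * (n * C + 1)) with hε
  have hε0 : 0 < ε := by positivity
  have hcover : (Set.univ : Set (Sphere d)) ⊆
      (⋃ s : Fin n → ℤˣ, cap (flip s X) ε) ∪ ⋃ i, slab (X i : E d) ε := by
    intro ξ _
    by_cases h : ∃ i, ξ ∈ slab (X i : E d) ε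
    · exact Or.inr (Set.mem_iUnion.2 h)
    · left
      simp only [slab, Set.mem_ofPred_eq, not_exists, not_le] at h
      refine Set.mem_iUnion.2 ⟨fun i => if 0 ≤ inner ℝ (X i : E d) (ξ : E d) then 1 else -1, ?_⟩
      intro i
      have hi := h i
      rw [coe_flip, real_inner_smul_left]
      split_ifs with h0
      · rw [abs_of_nonneg h0] at hi
        simpa using hi.le
      · rw [abs_of_neg (not_le.1 h0)] at hi
        simpa using hi.le
  have h1 : 1 ≤ ∑ s : Fin n → ℤˣ, 𝒟.real (cap (flip s X) ε) + n * (C * ε) := by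
    calc (1 : ℝ) = 𝒟.real Set.univ := by simp
      _ ≤ _ := measureReal_mono hcover
      _ ≤ _ := measureReal_union_le _ _
      _ ≤ _ := add_le_add (measureReal_iUnion_fintype_le _) (measureReal_iUnion_slab_le hC X hε0.le)
  have h2 : n * (C * ε) ≤ 1 / 2 := by
    rw [hε, ← mul_assoc, mul_one_div, div_le_div_iff₀ (by positivity) zero_lt_two]
    linarith
  obtain ⟨s, -, hs⟩ := Finset.exists_le_of_sum_le (s := Finset.univ)
    (f := fun _ : Fin n → ℤˣ => 1 / (2 * (Fintype.card (Fin n → ℤˣ) : ℝ)))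
    (g := fun s => 𝒟.real (cap (flip s X) ε)) Finset.univ_nonempty (by
      rw [Finset.sum_const, Finset.card_univ, nsmul_eq_mul]
      have : (Fintype.card (Fin n → ℤˣ) : ℝ) * (1 / (2 * (Fintype.card (Fin n → ℤˣ) : ℝ))) = 1 / 2 := by
        field_simp
      rw [this]
      linarith)
  exact ⟨s, hs⟩

end Slab

/-! ### Measurability of the dynamics and of failure. -/

section Measurability

theorem sign_eq_sign_iff {a b : ℝ} :
    SignType.sign a = SignType.sign b ↔ (0 < a ↔ 0 < b) ∧ (a < 0 ↔ b < 0) := by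
  rcases lt_trichotomy a 0 with ha | rfl | ha <;> rcases lt_trichotomy b 0 with hb | rfl | hb <;>
    simp [sign_pos, sign_neg, *, not_lt_of_gt]

theorem measurableSet_sign_eq {α : Type*} [MeasurableSpace α] {f g : α → ℝ} (hf : Measurable f)
    (hg : Measurable g) : MeasurableSet {a | SignType.sign (f a) = SignType.sign (g a)} := by
  simp only [sign_eq_sign_iff]
  have hpos : ∀ {k : α → ℝ}, Measurable k → Measurable fun a => 0 < k a := fun hk =>
    measurableSet_setOfPred.1 (measurableSet_lt measurable_const hk)
  have hneg : ∀ {k : α → ℝ}, Measurable k → Measurable fun a => k a < 0 := fun hk =>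
    measurableSet_setOfPred.1 (measurableSet_lt hk measurable_const)
  exact measurableSet_setOfPred.2
    (((hpos hf).iff (hpos hg)).and ((hneg hf).iff (hneg hg)))

theorem measurable_unnormalizedUpdate (η : Fin n → Fin n → ℝ) (i : Fin n) :
    Measurable fun p : Sphere d × Config n d => unnormalizedUpdate η p.1 p.2 i := by
  have hX : ∀ j, Measurable fun p : Sphere d × Config n d => (p.2 j : E d) := fun j => by fun_prop
  have hinner : ∀ j, Measurable fun p : Sphere d × Config n d =>
      inner ℝ (p.2 j : E d) (p.1 : E d) := fun j => by fun_prop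
  have hsign := fun j => measurableSet_sign_eq (hinner j) (hinner i)
  have hterm : ∀ j, Measurable fun p : Sphere d × Config n d => η i j • (p.2 j : E d) := fun j =>
    (hX j).const_smul (η i j)
  simp only [unnormalizedUpdate, Finset.sum_filter]
  refine (hX i).add (Measurable.sub ?_ ?_)
  · exact Finset.measurable_fun_sum _ fun j _ =>
      Measurable.ite (hsign j) (hterm j) measurable_const
  · exact Finset.measurable_fun_sum _ fun j _ =>
      Measurable.ite (hsign j).compl (hterm j) measurable_const

theorem measurable_step (η : Fin n → Fin n → ℝ) :
    Measurable fun p : Sphere d × Config n d => step η p.1 p.2 := by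
  classical
  refine measurable_pi_lambda _ fun i =>
    (MeasurableEmbedding.subtype_coe Metric.isClosed_sphere.measurableSet).measurable_comp_iff.1 ?_
  have hU := measurable_unnormalizedUpdate (d := d) η i
  have hX : Measurable fun p : Sphere d × Config n d => (p.2 i : E d) := by fun_prop
  have heq : ((↑) ∘ fun p : Sphere d × Config n d => step η p.1 p.2 i : _ → E d) = fun p =>
      if unnormalizedUpdate η p.1 p.2 i = 0 then (p.2 i : E d)
      else ‖unnormalizedUpdate η p.1 p.2 i‖⁻¹ • unnormalizedUpdate η p.1 p.2 i := by
    funext p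
    simp only [Function.comp_apply, step]
    split_ifs <;> rfl
  rw [heq]
  exact Measurable.ite (hU (measurableSet_singleton 0)) hX (hU.norm.inv.smul hU)

theorem measurable_trajectory (η : Fin n → Fin n → ℝ) (x : Config n d) (t : ℕ) :
    Measurable fun ξ : ℕ → Sphere d => trajectory η x ξ t := by
  induction t with
  | zero => exact measurable_const
  | succ t ih => 
    have hp : Measurable fun ξ : ℕ → Sphere d => (ξ t, trajectory η x ξ t) :=
      (measurable_pi_apply t).prodMk ih
    exact (measurable_step η).comp hp

theorem continuous_toEuclidean : Continuous (Config.toEuclidean (n := n) (d := d)) := by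
  unfold Config.toEuclidean
  fun_prop

/-- The update sequences for which the party model started at `x` does not polarize. -/
def nonPolarizing (η : Fin n → Fin n → ℝ) (x : Config n d) : Set (ℕ → Sphere d) :=
  {ξ | ¬Tendsto (fun t => Metric.infDist (trajectory η x ξ t).toEuclidean (polarizedSet n d))
    atTop (𝓝 0)}

theorem measurableSet_nonPolarizing (η : Fin n → Fin n → ℝ) (x : Config n d) :
    MeasurableSet (nonPolarizing η x) := by
  refine (measurableSet_tendsto (𝓝 0) fun t => ?_).compl
  exact ((Metric.continuous_infDist_pt _).comp continuous_toEuclidean).measurable.comp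
    (measurable_trajectory η x t)

end Measurability

theorem trajectory_succ (η : Fin n → Fin n → ℝ) (x : Config n d) (ξ : ℕ → Sphere d) (t : ℕ) :
    trajectory η x ξ (t + 1) = trajectory η (step η (ξ 0) x) (fun s => ξ (s + 1)) t := by
  induction t with
  | zero => rfl
  | succ t ih => rw [trajectory, ih, trajectory]

/-- A limit is unaffected by dropping the first term. -/
theorem mem_nonPolarizing_iff (η : Fin n → Fin n → ℝ) (x : Config n d) (ξ : ℕ → Sphere d) :
    ξ ∈ nonPolarizing η x ↔ (fun s => ξ (s + 1)) ∈ nonPolarizing η (step η (ξ 0) x) := by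
  refine not_congr ?_
  rw [← tendsto_add_atTop_iff_nat 1]
  simp only [trajectory_succ]

/-! ### Splitting off the first term of an i.i.d. sequence. -/

section Cons

variable {α : Type*}

/-- The sequence `a, f 0, f 1, …`. -/
def consSeq (p : α × (ℕ → α)) : ℕ → α
  | 0 => p.1
  | k + 1 => p.2 k

theorem consSeq_zero (p : α × (ℕ → α)) : consSeq p 0 = p.1 := rfl

theorem consSeq_succ (p : α × (ℕ → α)) (k : ℕ) : consSeq p (k + 1) = p.2 k := rfl

variable [MeasurableSpace α]

theorem measurable_consSeq : Measurable (consSeq (α := α)) := by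
  refine measurable_pi_lambda _ fun k => ?_
  cases k with
  | zero => exact measurable_fst
  | succ k => exact (measurable_pi_apply k).comp measurable_snd

/-- An i.i.d. sequence preceded by an independent sample is an i.i.d. sequence. -/
theorem measurePreserving_consSeq (𝒟 : Measure α) [IsProbabilityMeasure 𝒟] :
    MeasurePreserving consSeq (𝒟.prod (Measure.infinitePi fun _ : ℕ => 𝒟))
      (Measure.infinitePi fun _ : ℕ => 𝒟) := by
  classical
  refine ⟨measurable_consSeq, Measure.eq_infinitePi _ fun s t ht => ?_⟩
  obtain ⟨N, hN⟩ : ∃ N, s ⊆ Finset.range (N + 1) :=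
    ⟨s.sup id, fun i hi => Finset.mem_range_succ_iff.2 (Finset.le_sup (f := id) hi)⟩
  -- Padding with the whole space turns the constraints on `s` into constraints on an initial
  -- segment, whose product splits off the factor at `0`.
  let u : ℕ → Set α := fun i => if i ∈ s then t i else Set.univ
  have hu : ∀ i, MeasurableSet (u i) := fun i => by
    simp only [u]
    split_ifs
    exacts [ht i, MeasurableSet.univ]
  have hpre : consSeq ⁻¹' Set.pi s t = u 0 ×ˢ Set.pi (Finset.range N) fun i => u (i + 1) := by
    ext p
    simp only [Set.mem_preimage, Set.mem_pi, Set.mem_prod, Finset.mem_coe, u]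
    constructor
    · intro h
      refine ⟨?_, fun i _ => ?_⟩
      · split_ifs with h0
        exacts [h 0 h0, Set.mem_univ _]
      · split_ifs with h0
        exacts [h (i + 1) h0, Set.mem_univ _]
    · rintro ⟨h0, h1⟩ i hi
      cases i with
      | zero => simpa [hi, consSeq_zero] using h0
      | succ i => simpa [hi, consSeq_succ] using h1 i (by simpa using hN hi)
  rw [Measure.map_apply measurable_consSeq (MeasurableSet.pi s.countable_toSet fun i _ => ht i), hpre,
    Measure.prod_prod, Measure.infinitePi_pi _ fun i _ => hu (i + 1), mul_comm,
    ← Finset.prod_range_succ' fun i => 𝒟 (u i)]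
  rw [← Finset.prod_subset hN (f := fun i => 𝒟 (u i)) fun i _ hi => by simp [u, hi]]
  exact Finset.prod_congr rfl fun i hi => by simp [u, hi]

end Cons

/-! ### Failure probabilities. -/

section Markov

variable {𝒟 : Measure (Sphere d)} [IsProbabilityMeasure 𝒟]

/-- The Markov property at time one: given the first direction, the remaining ones are again i.i.d.
and drive the model from the new configuration. -/
theorem infinitePi_nonPolarizing (η : Fin n → Fin n → ℝ) (x : Config n d) :
    Measure.infinitePi (fun _ : ℕ => 𝒟) (nonPolarizing η x) =
      ∫⁻ ξ, Measure.infinitePi (fun _ : ℕ => 𝒟) (nonPolarizing η (step η ξ x)) ∂𝒟 := by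
  have hmeas : MeasurableSet (consSeq ⁻¹' nonPolarizing η x) :=
    measurable_consSeq (measurableSet_nonPolarizing η x)
  have h1 := (measurePreserving_consSeq 𝒟).measure_preimage
    (measurableSet_nonPolarizing η x).nullMeasurableSet
  have h2 : ∀ ξ : Sphere d, Prod.mk ξ ⁻¹' (consSeq ⁻¹' nonPolarizing η x) =
      nonPolarizing η (step η ξ x) := by
    intro ξ
    ext f
    rw [Set.mem_preimage, Set.mem_preimage, mem_nonPolarizing_iff]
    simp only [consSeq_zero, consSeq_succ]
  rw [← h1, Measure.prod_apply hmeas]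
  simp only [h2]

/-- The probability that the party model started at `x` does not polarize. -/
def failureProb (𝒟 : Measure (Sphere d)) [IsProbabilityMeasure 𝒟] (η : Fin n → Fin n → ℝ)
    (x : Config n d) : ℝ :=
  (Measure.infinitePi fun _ : ℕ => 𝒟).real (nonPolarizing η x)

/-- First-step analysis: `u` bounds the failure probability after a direction in `S`, and the global
bound `M` serves for all others. -/
theorem failureProb_le_add {η : Fin n → Fin n → ℝ} {x : Config n d} {S : Set (Sphere d)}
    (hS : MeasurableSet S) {u M : ℝ} (hu : ∀ ξ ∈ S, failureProb 𝒟 η (step η ξ x) ≤ u)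
    (hM : ∀ y, failureProb 𝒟 η y ≤ M) (hu0 : 0 ≤ u) :
    failureProb 𝒟 η x ≤ 𝒟.real S * u + (1 - 𝒟.real S) * M := by
  have hM0 : 0 ≤ M := measureReal_nonneg.trans (hM x)
  have key : Measure.infinitePi (fun _ : ℕ => 𝒟) (nonPolarizing η x) ≤
      ENNReal.ofReal u * 𝒟 S + ENNReal.ofReal M * 𝒟 Sᶜ := by
    rw [infinitePi_nonPolarizing, ← lintegral_add_compl _ hS]
    refine add_le_add ?_ ?_
    · rw [← setLIntegral_const]
      refine setLIntegral_mono' hS fun ξ hξ => ?_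
      rw [← ofReal_measureReal]
      exact ENNReal.ofReal_le_ofReal (hu ξ hξ)
    · rw [← setLIntegral_const]
      refine setLIntegral_mono' hS.compl fun ξ _ => ?_
      rw [← ofReal_measureReal]
      exact ENNReal.ofReal_le_ofReal (hM _)
  have := ENNReal.toReal_mono (by finiteness) key
  rw [ENNReal.toReal_add (by finiteness) (by finiteness), ENNReal.toReal_mul, ENNReal.toReal_mul,
    ENNReal.toReal_ofReal hu0, ENNReal.toReal_ofReal hM0] at this
  rw [← probReal_compl_eq_one_sub hS]
  calc failureProb 𝒟 η x ≤ u * 𝒟.real S + M * 𝒟.real Sᶜ := this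
    _ = _ := by ring

/-- Union bound: if the opinions approach each other geometrically under the consensus dynamics,
with high probability no update vector ever separates them. -/
theorem failureProb_flip_le (hn : 1 ≤ n) {η : Fin n → Fin n → ℝ} {C K r : ℝ} (hC0 : 0 ≤ C)
    (hC : ∀ (x : Sphere d) (ε : ℝ), 0 ≤ ε → 𝒟.real (slab (x : E d) ε) ≤ C * ε)
    (hK : 0 ≤ K) (hr : 0 ≤ r) (hr1 : r < 1) {Y : Config n d}
    (hY : ∀ t i j,
      ‖((consensus η)^[t] Y i : E d) - ((consensus η)^[t] Y j : E d)‖ ≤ K * r ^ t)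
    (s : Fin n → ℤˣ) :
    failureProb 𝒟 η (flip s Y) ≤ n * C * K / (1 - r) := by
  let B : ℕ → Set (ℕ → Sphere d) := fun t =>
    (fun ξ => ξ t) ⁻¹' ⋃ i, slab ((consensus η)^[t] Y i : E d) (K * r ^ t)
  have hsub : nonPolarizing η (flip s Y) ⊆ ⋃ t, B t := by
    intro ξ hξ
    by_contra hB
    simp only [B, Set.mem_iUnion, not_exists] at hB
    have hside : ∀ t, SameSide ((consensus η)^[t] Y) (ξ t) := by
      intro t
      by_contra hns
      obtain ⟨i, hi⟩ := Set.mem_iUnion.1 (not_sameSide_subset_iUnion_slab (hY t) hns)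
      exact hB t (Set.mem_iUnion.2 ⟨i, hi⟩)
    refine hξ ?_
    simp only [trajectory_flip hside]
    refine squeeze_zero (fun t => Metric.infDist_nonneg) (fun t => infDist_flip_le hn s (hY t)) ?_
    have := ((tendsto_pow_atTop_nhds_zero_of_lt_one hr hr1).const_mul K).const_mul (Real.sqrt n)
    simpa using this
  have hBt : ∀ t, (Measure.infinitePi fun _ : ℕ => 𝒟) (B t) ≤
      ENNReal.ofReal (n * C * K * r ^ t) := by
    intro t
    have hmeas : MeasurableSet (⋃ i, slab ((consensus η)^[t] Y i : E d) (K * r ^ t)) :=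
      MeasurableSet.iUnion fun i => measurableSet_slab _ _
    rw [(measurePreserving_eval_infinitePi (fun _ : ℕ => 𝒟) t).measure_preimage
      hmeas.nullMeasurableSet, ← ofReal_measureReal]
    refine ENNReal.ofReal_le_ofReal ?_
    have := measureReal_iUnion_slab_le hC ((consensus η)^[t] Y) (ε := K * r ^ t) (by positivity)
    linarith
  have hgeom : HasSum (fun t => n * C * K * r ^ t) (n * C * K / (1 - r)) := by
    rw [div_eq_mul_inv]
    exact (hasSum_geometric_of_lt_one hr hr1).mul_left _
  have h1r : 0 < 1 - r := by linarith
  refine ENNReal.toReal_le_of_le_ofReal (by positivity) ?_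
  calc (Measure.infinitePi fun _ : ℕ => 𝒟) (nonPolarizing η (flip s Y))
      ≤ ∑' t, (Measure.infinitePi fun _ : ℕ => 𝒟) (B t) :=
        (measure_mono hsub).trans (measure_iUnion_le _)
    _ ≤ ∑' t, ENNReal.ofReal (n * C * K * r ^ t) := ENNReal.tsum_le_tsum hBt
    _ = ENNReal.ofReal (n * C * K / (1 - r)) := by
        rw [← ENNReal.ofReal_tsum_of_nonneg (fun t => by positivity) hgeom.summable,
          hgeom.tsum_eq]

theorem failureProb_eq_zero (hn : 1 ≤ n) {η : Fin n → Fin n → ℝ} (hη : ∀ i j, 0 ≤ η i j)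
    (hA : IsIrreducible (influenceMatrix η)) (h𝒟 : EquivalentToUniform 𝒟) (x : Config n d) :
    failureProb 𝒟 η x = 0 := by
  obtain ⟨C, hC0, hC⟩ := exists_measureReal_slab_le h𝒟
  obtain ⟨ε, b, hε, hb, hcap⟩ := exists_flip_cap h𝒟 n
  obtain ⟨K, r, hK, hr, hr1, hcontr⟩ := exists_consensus_contraction (d := d) hη hA hε
  have hbdd : BddAbove (Set.range (failureProb 𝒟 η)) :=
    ⟨1, by rintro _ ⟨y, rfl⟩; exact measureReal_le_one⟩
  set M := ⨆ y, failureProb 𝒟 η y with hMdef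
  have hM : ∀ y, failureProb 𝒟 η y ≤ M := le_ciSup hbdd
  have hnonneg : ∀ y, 0 ≤ failureProb 𝒟 η y := fun y => measureReal_nonneg
  set L := n * C * K / (1 - r) with hL
  -- Within `T` steps the process contracts as if driven by a fixed direction, with probability at
  -- least `b ^ T`; the failure probability from there is at most `L * r ^ T`.
  have hgain : ∀ T y, b ^ T * (M - L * r ^ T) ≤ M - failureProb 𝒟 η y := by
    intro T y
    obtain ⟨s, hs⟩ := hcap y
    set Y := flip s y with hY
    have hne : (cap Y ε).Nonempty := by
      rw [Set.nonempty_iff_ne_empty]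
      intro h0
      rw [h0, measureReal_empty] at hs
      linarith
    obtain ⟨e, he⟩ := hne
    -- A direction positive on `Y` stays positive on every consensus iterate, so the same `s` and
    -- the same cap serve at each step, and the next configuration does not depend on which
    -- direction of the cap occurs.
    have hstep : ∀ k, b * (M - failureProb 𝒟 η (flip s ((consensus η)^[k + 1] Y))) ≤
        M - failureProb 𝒟 η (flip s ((consensus η)^[k] Y)) := by
      intro k
      have := failureProb_le_add (𝒟 := 𝒟) (η := η) (x := flip s ((consensus η)^[k] Y))
        (measurableSet_cap Y ε) (u := failureProb 𝒟 η (flip s ((consensus η)^[k + 1] Y)))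
        (fun ξ hξ => by
          rw [step_flip (Or.inl (inner_iterate_consensus_pos hη
            (fun j => hε.trans_le (hξ j)) k)), Function.iterate_succ_apply'])
        hM (hnonneg _)
      have h2 := mul_le_mul_of_nonneg_right hs
        (sub_nonneg.2 (hM (flip s ((consensus η)^[k + 1] Y))))
      linarith
    have hiter : ∀ k, b ^ k * (M - failureProb 𝒟 η (flip s ((consensus η)^[k] Y))) ≤
        M - failureProb 𝒟 η y := by
      intro k
      induction k with
      | zero => simp [hY, flip_flip]
      | succ k ih =>
        refine le_trans ?_ ih
        rw [pow_succ, mul_assoc]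
        exact mul_le_mul_of_nonneg_left (hstep k) (by positivity)
    refine le_trans ?_ (hiter T)
    -- Restarting at time `T` replaces the constant `K` by `K * r ^ T`.
    have hlast : failureProb 𝒟 η (flip s ((consensus η)^[T] Y)) ≤ L * r ^ T := by
      have := failureProb_flip_le (𝒟 := 𝒟) (η := η) hn hC0 hC (K := K * r ^ T) (by positivity)
        hr.le hr1 (Y := (consensus η)^[T] Y) (fun t i j => by
          rw [← Function.iterate_add_apply, mul_assoc, ← pow_add, add_comm T t]
          exact hcontr Y e he (t + T) i j) s
      refine this.trans (le_of_eq ?_)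
      rw [hL]
      ring
    gcongr
  -- If `M` exceeded `L * r ^ T`, all failure probabilities would stay below their supremum by a
  -- fixed positive amount.
  have hMT : ∀ T, M ≤ L * r ^ T := by
    intro T
    by_contra hlt
    rw [not_le] at hlt
    have hpos : 0 < b ^ T * (M - L * r ^ T) := mul_pos (pow_pos hb T) (sub_pos.2 hlt)
    have : Nonempty (Config n d) := ⟨x⟩
    have : M ≤ M - b ^ T * (M - L * r ^ T) := ciSup_le fun y => by linarith [hgain T y]
    linarith
  have hM0 : M ≤ 0 := by
    refine ge_of_tendsto' (x := atTop) (f := fun T : ℕ => L * r ^ T) ?_ hMT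
    simpa using (tendsto_pow_atTop_nhds_zero_of_lt_one hr.le hr1).const_mul L
  exact le_antisymm ((hM x).trans hM0) (hnonneg x)

end Markov

end PartyModel

end

theorem mainTheorem2 {n d : ℕ} (hn : 1 ≤ n)
    (η : Fin n → Fin n → ℝ) (hη : ∀ i j, 0 ≤ η i j)
    (hA : PartyModel.IsIrreducible (PartyModel.influenceMatrix η))
    (𝒟 : Measure (PartyModel.Sphere d)) (h𝒟 : PartyModel.EquivalentToUniform 𝒟)
    {Ω : Type*} [MeasurableSpace Ω] (Pr : Measure Ω) [IsProbabilityMeasure Pr]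
    (ξ : ℕ → Ω → PartyModel.Sphere d)
    (hlaw : ∀ t, HasLaw (ξ t) 𝒟 Pr) (hindep : iIndepFun ξ Pr)
    (x₀ : PartyModel.Config n d) :
    PartyModel.StronglyPolarizes Pr
      (fun t ω => PartyModel.trajectory η x₀ (fun s => ξ s ω) t) := by
  have : IsProbabilityMeasure 𝒟 := by
    rw [← (hlaw 0).map_eq]
    exact Measure.isProbabilityMeasure_map (hlaw 0).aemeasurable
  -- By independence the driving sequence has the infinite product law, so the claim becomes the
  -- vanishing of `failureProb` at `x₀`.
  have hseq := hindep.hasLaw_infinitePi hlaw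
    (aemeasurable_pi_iff.2 fun t => (hlaw t).aemeasurable)
  have hzero := PartyModel.failureProb_eq_zero hn hη hA h𝒟 x₀
  rw [PartyModel.failureProb, measureReal_eq_zero_iff, ← hseq.map_eq,
    Measure.map_apply_of_aemeasurable hseq.aemeasurable
      (PartyModel.measurableSet_nonPolarizing η x₀)] at hzero
  exact hzero
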